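/- For positive integers $a_1,\dots,a_t$ let $\langle a_1,\dots,a_t\rangle$ be the continuant: $\langle\varnothing\rangle=1$, $\langle a_1\rangle=a_1$, $\langle a_1,\dots,a_{j+1}\rangle=a_{j+1}\langle a_1,\dots,a_j\rangle+\langle a_1,\dots,a_{j-1}\rangle$. Let $n\ge 2$ and $S\ge 2n+2$ be integers, and let $U_n(S)$ be the set of all finite sequences (of any length $t$) with entries in $\{1,\dots,n\}$ and sum $S$. Put $$S_0=(n+1)\left\{\frac{S-1}{n+1}\right\}+1,\qquad S_1=n\left\{\frac{S}{n}\right\},$$ where $\{\cdot\}$ denotes the fractional part, and $$P(S)=\begin{cases}\{1,2,\dots,n-1\}, & S\ge n^2-1,\\ \{S_0,S_0+1,\dots,S_1\}, & S<n^2-1 \text{ and } S_0\le S_1,\\ \{1,2,\dots,S_1\}\cup\{S_0,S_0+1,\dots,n-1\}, & S<n^2-1 \text{ and } S_0>S_1,\end{cases}$$ where $\{a,a+1,\dots,b\}$ is empty if $a>b$. For $z\in P(S)$ let $x=x(z)$ be the integer with $$0\le x\le n,\qquad x\equiv z-S \pmod{n+1},$$ put $$m=m(z)=\frac{S-z-nx}{n+1}$$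 (an integer), and let $P^*(S)=\{z\in P(S): m(z)\ge 1\}$. For integers $m\ge 1$, $0\le x\le n$ and $1\le z\le n-1$ put $$T_z(m,x)=\langle\underbrace{1,n,1,n,\dots,1,n}_{2(m-\lfloor m/2\rfloor)\text{ elements}},\ \underbrace{n,\dots,n}_{x\text{ elements}},\ z,\ \underbrace{n,1,n,1,\dots,n,1}_{2\lfloor m/2\rfloor\text{ elements}}\rangle .$$ Then $P^*(S)$ is non-empty and $$\min_{(a_1,\dots,a_t)\in U_n(S)}\langle a_1,\dots,a_t\rangle=\min_{z\in P^*(S)}T_z(m(z),x(z)).$$ -/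

import Mathlib

/-- The continuant of a sequence that is listed from its last entry to its first. -/
def continuantRev : List ℕ → ℕ
  | [] => 1
  | [a] => a
  | a :: b :: l => a * continuantRev (b :: l) + continuantRev l

/-- The continuant `⟨a₁, …, a_t⟩`, defined by the recursion on the last entry. -/
def continuant (l : List ℕ) : ℕ := continuantRev l.reverse

theorem continuant_nil : continuant [] = 1 := rfl

theorem continuant_singleton (a : ℕ) : continuant [a] = a := rfl

/-- `⟨a₁, …, a_{j+1}⟩ = a_{j+1} ⟨a₁, …, a_j⟩ + ⟨a₁, …, a_{j-1}⟩`. -/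
theorem continuant_append_pair (l : List ℕ) (b a : ℕ) :
    continuant (l ++ [b, a]) = a * continuant (l ++ [b]) + continuant l := by
  simp [continuant, continuantRev]

/-- `U(S, t, n)`: the sequences of length `t` with entries in `{1, …, n}` and sum `S`. -/
def boundedSeqs (S t n : ℕ) : Set (List ℕ) :=
  {l | l.length = t ∧ (∀ a ∈ l, 1 ≤ a ∧ a ≤ n) ∧ l.sum = S}

/-- `U_n(S)`: the union of the sets `U(S, t, n)` over all lengths `t`. -/
def allBoundedSeqs (n S : ℕ) : Set (List ℕ) := ⋃ t : ℕ, boundedSeqs S t n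

/-- `N_z(x)`: the sequence `n, …, n, z` (`x` copies of `n`) if `x ≥ 0`, and the sequence
`1, …, 1, z, 1` (`-1-x` copies of `1` in front) if `x < 0`. -/
def middleBlock (n z : ℕ) (x : ℤ) : List ℕ :=
  if 0 ≤ x then List.replicate x.toNat n ++ [z]
  else List.replicate (-1 - x).toNat 1 ++ [z, 1]

/-- `T_z(m, x) = ⟨1, n, …, 1, n, N_z(x), n, 1, …, n, 1⟩` with `m₊ = m - ⌊m/2⌋` pairs `1, n`
in front and `m₋ = ⌊m/2⌋` pairs `n, 1` behind. -/
def T (n z m : ℕ) (x : ℤ) : ℕ :=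
  continuant ((List.replicate (m - m / 2) [1, n]).flatten ++ middleBlock n z x
    ++ (List.replicate (m / 2) [n, 1]).flatten)

/-- `S₀ = (n + 1) {(S - 1) / (n + 1)} + 1`, where `{·}` is the fractional part. -/
def S₀ (n S : ℕ) : ℕ := (S - 1) % (n + 1) + 1

/-- `S₁ = n {S / n}`, where `{·}` is the fractional part. -/
def S₁ (n S : ℕ) : ℕ := S % n

theorem S₀_eq (n S : ℕ) (hS : 1 ≤ S) :
    (S₀ n S : ℚ) = (n + 1) * Int.fract (((S : ℚ) - 1) / (n + 1)) + 1 := by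
  obtain ⟨k, rfl⟩ := Nat.exists_eq_add_of_le' hS
  have h := Int.fract_div_natCast_eq_div_natCast_mod (k := ℚ) (m := k) (n := n + 1)
  push_cast at h
  have hne : (n : ℚ) + 1 ≠ 0 := by positivity
  simp only [S₀, Nat.add_sub_cancel, Nat.cast_add, Nat.cast_one, add_sub_cancel_right, h]
  field_simp

theorem S₁_eq (n S : ℕ) (hn : 1 ≤ n) : (S₁ n S : ℚ) = n * Int.fract ((S : ℚ) / n) := by
  have hne : (n : ℚ) ≠ 0 := by positivity
  rw [Int.fract_div_natCast_eq_div_natCast_mod, S₁]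
  field_simp

/-- The set `P(S) ⊆ {1, …, n-1}`. -/
def P (n S : ℕ) : Finset ℕ :=
  if n ^ 2 - 1 ≤ S then Finset.Icc 1 (n - 1)
  else if S₀ n S ≤ S₁ n S then Finset.Icc (S₀ n S) (S₁ n S)
  else Finset.Icc 1 (S₁ n S) ∪ Finset.Icc (S₀ n S) (n - 1)

/-- The integer `x` with `0 ≤ x ≤ n` and `x ≡ z - S (mod n + 1)`. -/
def xOf (n S z : ℕ) : ℤ := ((z : ℤ) - S) % ((n : ℤ) + 1)

theorem eq_xOf_iff (n S z : ℕ) (x : ℤ) :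
    x = xOf n S z ↔ 0 ≤ x ∧ x ≤ n ∧ x ≡ (z : ℤ) - S [ZMOD (n : ℤ) + 1] := by
  have hpos : (0 : ℤ) < (n : ℤ) + 1 := by positivity
  constructor
  · rintro rfl
    refine ⟨Int.emod_nonneg _ hpos.ne', ?_, Int.mod_modEq _ _⟩
    have := Int.emod_lt_of_pos ((z : ℤ) - S) hpos
    unfold xOf
    omega
  · rintro ⟨h0, h1, h⟩
    have h2 : x % ((n : ℤ) + 1) = x := Int.emod_eq_of_lt h0 (by omega)
    rw [← h2]
    exact h

/-- The integer `m(z) = (S - z - n x) / (n + 1)`; the division is exact, see `mOf_mul`. -/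
def mOf (n S z : ℕ) : ℤ := ((S : ℤ) - z - n * xOf n S z) / ((n : ℤ) + 1)

theorem mOf_mul (n S z : ℕ) :
    ((n : ℤ) + 1) * mOf n S z = (S : ℤ) - z - n * xOf n S z := by
  refine Int.mul_ediv_cancel' ?_
  obtain ⟨k, hk⟩ := (((eq_xOf_iff n S z _).1 rfl).2.2).dvd
  exact ⟨-k - xOf n S z, by linarith⟩

/-- `P*(S) = {z ∈ P(S) : m(z) ≥ 1}`. -/
def PStar (n S : ℕ) : Finset ℕ := {z ∈ P n S | 1 ≤ mOf n S z}

/-!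
A word `w` with entries in `{1, …, n}` and sum `S` is regarded as a product of the matrices
`!![a, 1; 1, 0]`. If `w = A ++ B ++ C`, its continuant is, up to a positive factor depending on `A`
and `C` only, the bilinear form `(1, α) M_B (1, γ)ᵀ`, where `α` is the continued fraction of the
reverse of `A` and `γ` that of `C` (`continuant_append_append`). So a block of a minimal word cannot
be exchanged for one with the same sum and a smaller form. Four exchanges determine the minimal
words:

* Moving one unit between two entries: the form is concave along this move, so at most one entry
  lies strictly between `1` and `n` (`IsMinWord.not_two_inner`).
* Merging adjacent entries `a, b` into `a + b` does not raise the form, so in a shortest minimal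
  word adjacent entries have a sum above `n` (`IsShortMinWord.isChain`): every entry below `n` is
  surrounded by entries `n`.
* Reversing a block `B`: the form changes by a positive multiple of `γ - α` times the
  difference of the continued fractions of `B` and `B.reverse` (`IsMinWord.not_reverse_lt`). This
  excludes an `n` at either end (after splitting it into `n - 1` and `1`), excludes a second run
  of copies of `n`, and then puts the run and the exceptional entry `z` side by side and in the middle, which
  leaves the words `1, n, …, 1, n, n, …, n, z, n, 1, …, n, 1` (`IsMinWord.exists_balanced`).
* Replacing `n + 1` copies of `n` by `n` pairs `1, n` lowers the form
  (`sandwich_altWord_lt_replicate`), so the run has `x ≤ n` extra copies of `n`. This comes down to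
  `(n + 2 - 1 / (n + 2)) ^ n < (n + 1 / (n + 1)) ^ (n + 1)` for `n ≥ 3`.

The sum of such a word is `S = m (n + 1) + n x + z`. With `0 ≤ x ≤ n` this determines `x` and `m`
from `z`, and comparing it with the division of `S` by `n` shows that every `z` with `m ≥ 1` lies in
`P(S)` (`mem_PStar_of_eq`).
-/

/-! ### Continuants as matrix products -/

/-- The product of the matrices `!![a, 1; 1, 0]` over the entries `a` of `l`. Its upper left entry
is the continuant of `l`. -/
def contMat (l : List ℕ) : Matrix (Fin 2) (Fin 2) ℚ :=
  (l.map fun a : ℕ => !![(a : ℚ), 1; 1, 0]).prod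

/-- The finite continued fraction `[0; a₁, …, a_t]`. -/
def contFrac : List ℕ → ℚ
  | [] => 0
  | a :: l => (a + contFrac l)⁻¹

/-- The value `(1, α) M (1, γ)ᵀ` of the bilinear form of `M` at the ends `α` and `γ`. -/
def sandwich (M : Matrix (Fin 2) (Fin 2) ℚ) (α γ : ℚ) : ℚ :=
  M 0 0 + α * M 1 0 + γ * M 0 1 + α * γ * M 1 1

@[simp] theorem contMat_nil : contMat [] = 1 := rfl

theorem contMat_cons (a : ℕ) (l : List ℕ) :
    contMat (a :: l) = !![(a : ℚ), 1; 1, 0] * contMat l := by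
  simp [contMat]

theorem contMat_append (A B : List ℕ) : contMat (A ++ B) = contMat A * contMat B := by
  simp [contMat]

theorem contMat_cons_zero (a : ℕ) (l : List ℕ) (j : Fin 2) :
    contMat (a :: l) 0 j = a * contMat l 0 j + contMat l 1 j := by
  simp [contMat_cons, Matrix.mul_apply, Fin.sum_univ_two]

theorem contMat_cons_one (a : ℕ) (l : List ℕ) (j : Fin 2) :
    contMat (a :: l) 1 j = contMat l 0 j := by
  simp [contMat_cons, Matrix.mul_apply, Fin.sum_univ_two]

theorem contMat_reverse (l : List ℕ) : contMat l.reverse = (contMat l).transpose := by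
  induction l with
  | nil => simp
  | cons a l ih =>
    rw [List.reverse_cons, contMat_append, ih, contMat_cons a l, Matrix.transpose_mul]
    congr 1
    ext i j
    fin_cases i <;> fin_cases j <;> simp [contMat]

theorem continuantRev_eq_contMat : ∀ l : List ℕ, (continuantRev l : ℚ) = contMat l 0 0
  | [] => by simp [continuantRev]
  | [a] => by simp [continuantRev, contMat]
  | a :: b :: l => by
    rw [contMat_cons_zero, contMat_cons_one, ← continuantRev_eq_contMat (b :: l),
      ← continuantRev_eq_contMat l]
    simp [continuantRev]

theorem continuant_eq_contMat (l : List ℕ) : (continuant l : ℚ) = contMat l 0 0 := by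
  rw [continuant, continuantRev_eq_contMat, contMat_reverse, Matrix.transpose_apply]

theorem continuant_reverse (l : List ℕ) : continuant l.reverse = continuant l := by
  have h : (continuant l.reverse : ℚ) = continuant l := by
    rw [continuant_eq_contMat, continuant_eq_contMat, contMat_reverse, Matrix.transpose_apply]
  exact_mod_cast h

theorem contMat_nonneg (l : List ℕ) (i j : Fin 2) : 0 ≤ contMat l i j := by
  induction l generalizing i with
  | nil => fin_cases i <;> fin_cases j <;> simp
  | cons a l ih =>
    fin_cases i
    · have h0 := ih 0
      have h1 := ih 1
      have : 0 ≤ (a : ℚ) * contMat l 0 j + contMat l 1 j := by positivity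
      simpa [contMat_cons_zero] using this
    · simpa [contMat_cons_one] using ih 0

theorem contMat_pos {l : List ℕ} (hl : ∀ a ∈ l, 1 ≤ a) : 0 < contMat l 0 0 := by
  induction l with
  | nil => simp
  | cons a l ih =>
    rw [contMat_cons_zero]
    have h0 := ih fun b hb => hl b (List.mem_cons_of_mem _ hb)
    have h1 := contMat_nonneg l 1 0
    have ha : (1 : ℚ) ≤ a := by exact_mod_cast hl a List.mem_cons_self
    nlinarith

/-! ### Finite continued fractions -/

@[simp] theorem contFrac_nil : contFrac [] = 0 := rfl

theorem contFrac_cons (a : ℕ) (l : List ℕ) : contFrac (a :: l) = (a + contFrac l)⁻¹ := rfl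

theorem contFrac_nonneg : ∀ l : List ℕ, 0 ≤ contFrac l
  | [] => le_rfl
  | a :: l => by
    have := contFrac_nonneg l
    rw [contFrac_cons]
    positivity

theorem contFrac_pos {l : List ℕ} (hl : ∀ a ∈ l, 1 ≤ a) (hne : l ≠ []) : 0 < contFrac l := by
  cases l with
  | nil => exact absurd rfl hne
  | cons a l =>
    have h := contFrac_nonneg l
    have ha : (1 : ℚ) ≤ a := by exact_mod_cast hl a List.mem_cons_self
    rw [contFrac_cons]
    positivity

theorem contFrac_le_one {l : List ℕ} (hl : ∀ a ∈ l, 1 ≤ a) : contFrac l ≤ 1 := by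
  cases l with
  | nil => simp
  | cons a l =>
    have h := contFrac_nonneg l
    have ha : (1 : ℚ) ≤ a := by exact_mod_cast hl a List.mem_cons_self
    rw [contFrac_cons]
    exact inv_le_one_of_one_le₀ (by linarith)

theorem contFrac_lt_one {l : List ℕ} (hl : ∀ a ∈ l, 1 ≤ a) (hne : l ≠ [1]) : contFrac l < 1 := by
  cases l with
  | nil => simp
  | cons a l =>
    have h := contFrac_nonneg l
    have ha : (1 : ℚ) ≤ a := by exact_mod_cast hl a List.mem_cons_self
    rw [contFrac_cons]
    refine inv_lt_one_of_one_lt₀ ?_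
    by_cases hl' : l = []
    · subst hl'
      have : a ≠ 1 := fun h => hne (by rw [h])
      have h2 : 2 ≤ a := by have := hl a List.mem_cons_self; omega
      have : (2 : ℚ) ≤ a := by exact_mod_cast h2
      linarith
    · have := contFrac_pos (fun b hb => hl b (List.mem_cons_of_mem _ hb)) hl'
      linarith

theorem contFrac_cons_lt_iff {a b : ℕ} {l m : List ℕ} (ha : 1 ≤ a) (hb : 1 ≤ b) :
    contFrac (b :: m) < contFrac (a :: l) ↔ (a : ℚ) + contFrac l < b + contFrac m := by
  have h1 := contFrac_nonneg l
  have h2 := contFrac_nonneg m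
  have ha : (1 : ℚ) ≤ a := by exact_mod_cast ha
  have hb : (1 : ℚ) ≤ b := by exact_mod_cast hb
  rw [contFrac_cons, contFrac_cons]
  exact inv_lt_inv₀ (by linarith) (by linarith)

/-- A smaller first partial quotient gives the larger continued fraction; the only exception is
`[0; a, 1] = [0; a + 1]`. -/
theorem contFrac_cons_lt {a b : ℕ} {l m : List ℕ} (hl : ∀ c ∈ l, 1 ≤ c) (hm : ∀ c ∈ m, 1 ≤ c)
    (ha : 1 ≤ a) (hab : a < b) (h : l ≠ [1] ∨ m ≠ []) :
    contFrac (b :: m) < contFrac (a :: l) := by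
  rw [contFrac_cons_lt_iff ha (by omega)]
  have hab' : (a : ℚ) + 1 ≤ b := by exact_mod_cast hab
  have h1 := contFrac_le_one hl
  have h2 := contFrac_nonneg m
  rcases h with h | h
  · have := contFrac_lt_one hl h
    linarith
  · have := contFrac_pos hm h
    linarith

theorem contMat_one_zero {l : List ℕ} (hl : ∀ a ∈ l, 1 ≤ a) :
    contMat l 1 0 = contFrac l * contMat l 0 0 := by
  induction l with
  | nil => simp
  | cons a l ih =>
    have hl' : ∀ b ∈ l, 1 ≤ b := fun b hb => hl b (List.mem_cons_of_mem _ hb)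
    have h := contFrac_nonneg l
    have ha : (1 : ℚ) ≤ a := by exact_mod_cast hl a List.mem_cons_self
    have hne : (a : ℚ) + contFrac l ≠ 0 := by positivity
    rw [contMat_cons_one, contMat_cons_zero, ih hl', contFrac_cons]
    field_simp

theorem contMat_zero_one {l : List ℕ} (hl : ∀ a ∈ l, 1 ≤ a) :
    contMat l 0 1 = contFrac l.reverse * contMat l 0 0 := by
  have h := contMat_one_zero (l := l.reverse) (by simpa using hl)
  simpa [contMat_reverse] using h

/-- The value of a continuant seen from a block `B` of the word: up to a factor that does not
depend on `B`, it is a bilinear form in the matrix of `B`. -/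
theorem continuant_append_append {A C : List ℕ} (B : List ℕ) (hA : ∀ a ∈ A, 1 ≤ a)
    (hC : ∀ a ∈ C, 1 ≤ a) :
    (continuant (A ++ B ++ C) : ℚ) = contMat A 0 0 * contMat C 0 0 *
      sandwich (contMat B) (contFrac A.reverse) (contFrac C) := by
  rw [continuant_eq_contMat, contMat_append, contMat_append]
  simp only [Matrix.mul_apply, Fin.sum_univ_two, contMat_one_zero hC, contMat_zero_one hA, sandwich]
  ring

theorem sandwich_transpose (M : Matrix (Fin 2) (Fin 2) ℚ) (α γ : ℚ) :
    sandwich M.transpose α γ = sandwich M α γ + (γ - α) * (M 1 0 - M 0 1) := by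
  simp only [sandwich, Matrix.transpose_apply]
  ring

theorem sandwich_cons (a : ℕ) (l : List ℕ) (α γ : ℚ) :
    sandwich (contMat (a :: l)) α γ =
      (a + α) * (contMat l 0 0 + γ * contMat l 0 1) + (contMat l 1 0 + γ * contMat l 1 1) := by
  simp only [sandwich, contMat_cons_zero, contMat_cons_one]
  ring

theorem sandwich_singleton (a : ℕ) (α γ : ℚ) :
    sandwich (contMat [a]) α γ = a + α + γ := by
  simp [sandwich, contMat]

theorem sandwich_pair (a b : ℕ) (α γ : ℚ) :
    sandwich (contMat [a, b]) α γ = (a + α) * (b + γ) + 1 := by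
  simp [sandwich, contMat_cons]
  ring

theorem sandwich_cons_append_singleton (a b : ℕ) (D : List ℕ) (α γ : ℚ) :
    sandwich (contMat (a :: (D ++ [b]))) α γ =
      (a + α) * (b + γ) * contMat D 0 0 + (a + α) * contMat D 0 1 + (b + γ) * contMat D 1 0
        + contMat D 1 1 := by
  rw [sandwich_cons, contMat_append]
  simp [Matrix.mul_apply, Fin.sum_univ_two, contMat]
  ring

/-! ### Minimal words and exchange arguments -/

theorem mem_allBoundedSeqs {n S : ℕ} {l : List ℕ} :
    l ∈ allBoundedSeqs n S ↔ (∀ a ∈ l, 1 ≤ a ∧ a ≤ n) ∧ l.sum = S := by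
  simp [allBoundedSeqs, boundedSeqs]

/-- `w` has the least continuant in `U_n(S)`. -/
def IsMinWord (n S : ℕ) (w : List ℕ) : Prop :=
  w ∈ allBoundedSeqs n S ∧ ∀ v ∈ allBoundedSeqs n S, continuant w ≤ continuant v

/-- `w` is a word of least length among those with the least continuant in `U_n(S)`. -/
def IsShortMinWord (n S : ℕ) (w : List ℕ) : Prop :=
  IsMinWord n S w ∧ ∀ v, IsMinWord n S v → w.length ≤ v.length

theorem exists_isShortMinWord {n : ℕ} (S : ℕ) (hn : 1 ≤ n) : ∃ w, IsShortMinWord n S w := by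
  have hU : (allBoundedSeqs n S).Nonempty :=
    ⟨List.replicate S 1, mem_allBoundedSeqs.2
      ⟨fun a ha => by rw [List.eq_of_mem_replicate ha]; exact ⟨le_rfl, hn⟩, by simp⟩⟩
  have hmin : {w | IsMinWord n S w}.Nonempty :=
    ⟨Function.argminOn continuant _ hU, Function.argminOn_mem _ _ hU,
      fun v hv => Function.argminOn_le continuant _ hv⟩
  exact ⟨Function.argminOn List.length _ hmin, Function.argminOn_mem _ _ hmin,
    fun v hv => Function.argminOn_le List.length _ hv⟩

namespace IsMinWord

variable {n S : ℕ} {w A B B' C : List ℕ}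

theorem one_le (h : IsMinWord n S w) {a : ℕ} (ha : a ∈ w) : 1 ≤ a :=
  ((mem_allBoundedSeqs.1 h.1).1 a ha).1

theorem le (h : IsMinWord n S w) {a : ℕ} (ha : a ∈ w) : a ≤ n :=
  ((mem_allBoundedSeqs.1 h.1).1 a ha).2

theorem sum_eq (h : IsMinWord n S w) : w.sum = S := (mem_allBoundedSeqs.1 h.1).2

theorem reverse (h : IsMinWord n S w) : IsMinWord n S w.reverse := by
  refine ⟨mem_allBoundedSeqs.2 ?_, fun v hv => by rw [continuant_reverse]; exact h.2 v hv⟩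
  simpa using mem_allBoundedSeqs.1 h.1

theorem replace_mem (h : IsMinWord n S (A ++ B ++ C)) (hB : ∀ a ∈ B', 1 ≤ a ∧ a ≤ n)
    (hsum : B'.sum = B.sum) : A ++ B' ++ C ∈ allBoundedSeqs n S := by
  obtain ⟨h1, h2⟩ := mem_allBoundedSeqs.1 h.1
  refine mem_allBoundedSeqs.2 ⟨fun a ha => ?_, by simpa [hsum] using h2⟩
  simp only [List.mem_append] at ha h1
  rcases ha with (ha | ha) | ha
  · exact h1 a (Or.inl (Or.inl ha))
  · exact hB a ha
  · exact h1 a (Or.inr ha)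

theorem sandwich_le (h : IsMinWord n S (A ++ B ++ C)) (hB : ∀ a ∈ B', 1 ≤ a ∧ a ≤ n)
    (hsum : B'.sum = B.sum) :
    sandwich (contMat B) (contFrac A.reverse) (contFrac C) ≤
      sandwich (contMat B') (contFrac A.reverse) (contFrac C) := by
  have hA : ∀ a ∈ A, 1 ≤ a := fun a ha => h.one_le (by simp [ha])
  have hC : ∀ a ∈ C, 1 ≤ a := fun a ha => h.one_le (by simp [ha])
  have hle : (continuant (A ++ B ++ C) : ℚ) ≤ continuant (A ++ B' ++ C) := by
    exact_mod_cast h.2 _ (h.replace_mem hB hsum)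
  rw [continuant_append_append _ hA hC, continuant_append_append _ hA hC] at hle
  exact le_of_mul_le_mul_left hle (mul_pos (contMat_pos hA) (contMat_pos hC))

theorem replace (h : IsMinWord n S (A ++ B ++ C)) (hB : ∀ a ∈ B', 1 ≤ a ∧ a ≤ n)
    (hsum : B'.sum = B.sum)
    (heq : sandwich (contMat B') (contFrac A.reverse) (contFrac C) ≤
      sandwich (contMat B) (contFrac A.reverse) (contFrac C)) :
    IsMinWord n S (A ++ B' ++ C) := by
  have hA : ∀ a ∈ A, 1 ≤ a := fun a ha => h.one_le (by simp [ha])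
  have hC : ∀ a ∈ C, 1 ≤ a := fun a ha => h.one_le (by simp [ha])
  have hle : (continuant (A ++ B' ++ C) : ℚ) ≤ continuant (A ++ B ++ C) := by
    rw [continuant_append_append _ hA hC, continuant_append_append _ hA hC]
    exact mul_le_mul_of_nonneg_left heq (mul_pos (contMat_pos hA) (contMat_pos hC)).le
  have hle' : continuant (A ++ B' ++ C) ≤ continuant (A ++ B ++ C) := by exact_mod_cast hle
  exact ⟨h.replace_mem hB hsum, fun v hv => hle'.trans (h.2 v hv)⟩

/-- Reversing a block changes the continuant by a multiple of the product of two differences of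
continued fractions, so in a minimal word these differences cannot have the same sign. -/
theorem not_reverse_lt (h : IsMinWord n S (A ++ B ++ C))
    (hAC : contFrac A.reverse < contFrac C) : contFrac B.reverse ≤ contFrac B := by
  have hB : ∀ a ∈ B, 1 ≤ a := fun a ha => h.one_le (by simp [ha])
  have hle := h.sandwich_le (B' := B.reverse)
    (fun a ha => ⟨hB a (by simpa using ha), h.le (by simp_all)⟩) (by simp)
  rw [contMat_reverse, sandwich_transpose, contMat_one_zero hB, contMat_zero_one hB, ← sub_mul] at hle
  by_contra! hlt
  have h1 := mul_pos (sub_pos.2 hAC) (mul_pos (sub_pos.2 hlt) (contMat_pos hB))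
  linarith

theorem not_reverse_gt (h : IsMinWord n S (A ++ B ++ C))
    (hAC : contFrac C < contFrac A.reverse) : contFrac B ≤ contFrac B.reverse := by
  have h' : IsMinWord n S (C.reverse ++ B.reverse ++ A.reverse) := by
    simpa [List.append_assoc] using h.reverse
  simpa using h'.not_reverse_lt (by simpa using hAC)

/-- The continuant is concave along `(a + t, b - t)` for two entries `a` and `b`, so that at most
one entry of a minimal word lies strictly between `1` and `n`. -/
theorem not_two_inner {D : List ℕ} {a b : ℕ} (h : IsMinWord n S (A ++ a :: (D ++ b :: C)))
    (ha : 1 < a) (ha' : a < n) (hb : 1 < b) (hb' : b < n) : False := by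
  have h' : IsMinWord n S (A ++ (a :: (D ++ [b])) ++ C) := by simpa using h
  have hD : ∀ d ∈ D, 1 ≤ d ∧ d ≤ n := fun d hd => ⟨h.one_le (by simp [hd]), h.le (by simp [hd])⟩
  obtain ⟨a, rfl⟩ := Nat.exists_eq_add_of_lt ha
  obtain ⟨b, rfl⟩ := Nat.exists_eq_add_of_lt hb
  have h1 := h'.sandwich_le (B' := (1 + a) :: (D ++ [1 + b + 1 + 1]))
    (by simp only [List.mem_cons, List.mem_append, List.not_mem_nil, or_false]
        rintro c (rfl | hc | rfl)
        · omega
        · exact hD c hc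
        · omega) (by simp; ring)
  have h2 := h'.sandwich_le (B' := (1 + a + 1 + 1) :: (D ++ [1 + b]))
    (by simp only [List.mem_cons, List.mem_append, List.not_mem_nil, or_false]
        rintro c (rfl | hc | rfl)
        · omega
        · exact hD c hc
        · omega) (by simp; ring)
  have h3 := contMat_pos fun d hd => (hD d hd).1
  simp only [sandwich_cons_append_singleton] at h1 h2
  push_cast at h1 h2
  nlinarith

/-- A final entry `n` may be split into `n - 1, 1`, after which reversing the block
`n, n - 1` in front of the final `1` lowers the continuant. -/
theorem not_append_pair (hn : 2 ≤ n) (h : IsMinWord n S (A ++ [n, n]))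
    (hne : A ≠ [1]) : False := by
  obtain ⟨n, rfl⟩ := Nat.exists_eq_add_of_le' (show 1 ≤ n by omega)
  have h' : IsMinWord (n + 1) S ((A ++ [n + 1]) ++ [n + 1] ++ []) := by simpa using h
  have h2 := h'.replace (B' := [n, 1]) (by simp; omega) (by simp)
    (by rw [sandwich_pair, sandwich_singleton]; simp; linarith)
  have h3 : IsMinWord (n + 1) S (A ++ [n + 1, n] ++ [1]) := by simpa using h2
  have hA : ∀ a ∈ A, 1 ≤ a := fun a ha => h.one_le (by simp [ha])
  have h4 := h3.not_reverse_lt (by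
    refine (contFrac_lt_one (by simpa using hA) ?_).trans_eq (by simp [contFrac_cons])
    simpa [List.reverse_eq_iff] using hne)
  refine absurd h4 (not_le.2 ?_)
  exact contFrac_cons_lt (by simp) (by simp; omega) (by omega) (by omega) (Or.inr (by simp))

end IsMinWord

/-! ### Local structure of shortest minimal words -/

theorem List.pairwise_of_forall_split {α : Type*} {R : α → α → Prop} {l : List α}
    (h : ∀ A a D b C, l = A ++ a :: (D ++ b :: C) → R a b) : l.Pairwise R := by
  induction l with
  | nil => exact List.Pairwise.nil
  | cons a l ih =>
    refine List.pairwise_cons.2 ⟨fun b hb => ?_, ih fun A c D b C hl => h (a :: A) c D b C (by simp [hl])⟩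
    obtain ⟨D, C, rfl⟩ := List.append_of_mem hb
    exact h [] a D b C rfl

/-- A list is cut after its maximal initial run of copies of `n`. -/
theorem List.exists_eq_replicate_append {α : Type*} (n : α) (l : List α) :
    ∃ k R, l = List.replicate k n ++ R ∧ ∀ a ∈ R.head?, a ≠ n := by
  induction l with
  | nil => exact ⟨0, [], by simp⟩
  | cons a l ih =>
    by_cases ha : a = n
    · obtain ⟨k, R, h, hR⟩ := ih
      exact ⟨k + 1, R, by simp [List.replicate_succ, ha, ← h], hR⟩
    · exact ⟨0, a :: l, by simpa using ha⟩

/-- A list is cut before its maximal final run of copies of `n`. -/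
theorem List.exists_eq_append_replicate {α : Type*} (n : α) (l : List α) :
    ∃ k R, l = R ++ List.replicate k n ∧ ∀ a ∈ R.getLast?, a ≠ n := by
  obtain ⟨k, R, h, hR⟩ := List.exists_eq_replicate_append n l.reverse
  refine ⟨k, R.reverse, ?_, by simpa using hR⟩
  rw [← List.reverse_reverse l, h]
  simp

namespace IsMinWord

variable {n S : ℕ} {w : List ℕ}

theorem pairwise (h : IsMinWord n S w) :
    w.Pairwise fun a b => ¬((1 < a ∧ a < n) ∧ 1 < b ∧ b < n) := by
  refine List.pairwise_of_forall_split ?_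
  rintro A a D b C rfl ⟨⟨h1, h2⟩, h3, h4⟩
  exact h.not_two_inner h1 h2 h3 h4

/-- After a run of at least two copies of `n` that is preceded by a smaller entry, no two
consecutive entries of a minimal word equal `n`: otherwise the part between the last `n` of the
first run and the second run would be reversed. -/
theorem isChain_after_run {P R : List ℕ} {y k : ℕ}
    (h : IsMinWord n S (P ++ y :: (List.replicate (k + 2) n ++ R))) (hy : y < n)
    (hR : ∀ a ∈ R.head?, a ≠ n) (hlast : ∀ a ∈ R.getLast?, a ≠ n) :
    R.IsChain fun a b => a + b < 2 * n := by
  rw [List.isChain_iff_forall_rel_of_append_cons_cons]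
  intro a b A C hAC
  by_contra hab
  have ha : a ≤ n := h.le (by simp [hAC])
  have hb : b ≤ n := h.le (by simp [hAC])
  obtain rfl : a = n := by omega
  obtain rfl : b = a := by omega
  obtain ⟨j, A', hA, hA'⟩ := List.exists_eq_append_replicate b A
  have hC : C ≠ [] := by
    rintro rfl
    exact hlast b (by simp [hAC]) rfl
  have hne : A' ≠ [] := by
    rintro rfl
    refine hR b ?_ rfl
    rw [hAC, hA]
    cases j <;> simp [List.replicate_succ]
  obtain ⟨D, y', rfl⟩ : ∃ D y', A' = D ++ [y'] :=
    ⟨_, _, (List.dropLast_append_getLast hne).symm⟩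
  have hy' : y' < b := lt_of_le_of_ne (h.le (by simp [hAC, hA])) (hA' y' (by simp))
  have hrep : ∀ l : List ℕ, List.replicate j b ++ b :: b :: l = b :: b :: (List.replicate j b ++ l) := by
    intro l
    have : ∀ l : List ℕ, List.replicate j b ++ b :: l = b :: (List.replicate j b ++ l) := by
      intro l
      rw [← List.singleton_append, ← List.append_assoc, ← List.replicate_succ', List.replicate_succ,
        List.cons_append]
    rw [this, this]
  have hw : P ++ y :: (List.replicate (k + 2) b ++ R) =
      (P ++ [y, b]) ++ (b :: ((List.replicate k b ++ D) ++ [y'])) ++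
        (b :: b :: (List.replicate j b ++ C)) := by
    rw [hAC, hA, ← hrep]
    simp [List.replicate_succ]
  have hpos : ∀ c ∈ P ++ y :: (List.replicate (k + 2) b ++ R), 1 ≤ c := fun c hc => h.one_le hc
  rw [hw] at h hpos
  have h1 := h.not_reverse_lt (by
    rw [List.reverse_append, List.reverse_cons, List.reverse_singleton, List.singleton_append,
      List.cons_append, List.singleton_append, contFrac_cons_lt_iff, add_lt_add_iff_left]
    · refine contFrac_cons_lt (fun c hc => hpos c ?_) (fun c hc => hpos c ?_) (hpos y ?_) hy
        (Or.inr (by simp [hC]))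
      · have : c ∈ P := by simpa using hc
        simp [this]
      · have : c ∈ List.replicate j b ∨ c ∈ C := by simpa using hc
        simp only [List.mem_append, List.mem_cons]
        tauto
      · simp
    · exact hpos b (by simp)
    · exact hpos b (by simp))
  refine absurd h1 (not_le.2 ?_)
  rw [List.reverse_cons, List.reverse_append, List.reverse_singleton, List.singleton_append,
    List.cons_append]
  refine contFrac_cons_lt (fun c hc => hpos c ?_) (fun c hc => hpos c ?_) (hpos y' ?_) hy'
    (Or.inr (by simp))
  · simp only [List.mem_append, List.mem_reverse, List.mem_cons, List.not_mem_nil, or_false] at hc ⊢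
    tauto
  · simp only [List.mem_append, List.mem_cons, List.not_mem_nil, or_false] at hc ⊢
    tauto
  · simp

/-- A minimal word does not end with `n`. -/
theorem getLast?_ne (h : IsMinWord n S w) (hn : 2 ≤ n) (hS : 2 * n + 2 ≤ S) :
    ∀ a ∈ w.getLast?, a ≠ n := by
  rintro a ha rfl
  obtain ⟨V, rfl⟩ := List.getLast?_eq_some_iff.1 ha
  have hsum := h.sum_eq
  rcases List.eq_nil_or_concat V with rfl | ⟨A, y, rfl⟩
  · simp at hsum
    omega
  have hy : y ≤ a := h.le (by simp)
  simp only [List.concat_eq_append] at h hsum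
  by_cases hya : y = a
  · subst hya
    refine (show IsMinWord y S (A ++ [y, y]) by simpa using h).not_append_pair hn ?_
    rintro rfl
    simp at hsum
    omega
  · have hA : A ≠ [] := by
      rintro rfl
      simp at hsum
      omega
    have hA1 : ∀ c ∈ A, 1 ≤ c := fun c hc => h.one_le (by simp [hc])
    have hy1 : 1 ≤ y := h.one_le (by simp)
    have h' : IsMinWord a S (A ++ [y, a] ++ []) := by simpa using h
    have h1 := h'.not_reverse_gt (contFrac_pos (by simpa using hA1) (by simpa using hA))
    refine absurd h1 (not_le.2 ?_)
    exact contFrac_cons_lt (by simp; omega) (by simp; omega) hy1 (by omega) (Or.inr (by simp))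

theorem head?_ne (h : IsMinWord n S w) (hn : 2 ≤ n) (hS : 2 * n + 2 ≤ S) :
    ∀ a ∈ w.head?, a ≠ n := by
  simpa using h.reverse.getLast?_ne hn hS

end IsMinWord

namespace IsShortMinWord

variable {n S : ℕ} {w : List ℕ}

/-- Merging adjacent entries `a, b` into `a + b` does not raise the continuant. -/
theorem isChain (h : IsShortMinWord n S w) : w.IsChain fun a b => n < a + b := by
  rw [List.isChain_iff_forall_rel_of_append_cons_cons]
  rintro a b A C rfl
  by_contra! hab
  have h' : IsMinWord n S (A ++ [a, b] ++ C) := by simpa using h.1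
  have ha : (1 : ℚ) ≤ a := by exact_mod_cast h'.one_le (a := a) (by simp)
  have hb : (1 : ℚ) ≤ b := by exact_mod_cast h'.one_le (a := b) (by simp)
  have ha' : 1 ≤ a := h'.one_le (by simp)
  have h2 := h'.replace (B' := [a + b]) (by simp; omega) (by simp) (by
    have h1 := contFrac_nonneg A.reverse
    have h2 := contFrac_nonneg C
    rw [sandwich_pair, sandwich_singleton]
    push_cast
    nlinarith [mul_nonneg (show 0 ≤ (a : ℚ) + contFrac A.reverse - 1 by linarith)
      (show 0 ≤ (b : ℚ) + contFrac C - 1 by linarith)])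
  have := h.2 _ h2
  simp at this

end IsShortMinWord

/-! ### Alternating words -/

/-- The word `a, b, a, b, …, a, b` with `k` pairs. -/
def altWord (a b k : ℕ) : List ℕ := (List.replicate k [a, b]).flatten

@[simp] theorem altWord_zero (a b : ℕ) : altWord a b 0 = [] := rfl

theorem altWord_succ (a b k : ℕ) : altWord a b (k + 1) = a :: b :: altWord a b k := by
  simp [altWord, List.replicate_succ]

theorem altWord_add (a b j k : ℕ) : altWord a b (j + k) = altWord a b j ++ altWord a b k := by
  rw [altWord, List.replicate_add, List.flatten_append]; rfl

theorem altWord_append_singleton (a b k : ℕ) : altWord a b k ++ [a] = a :: altWord b a k := by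
  induction k with
  | zero => rfl
  | succ k ih => simp [altWord_succ, ih]

theorem altWord_append_cons (a b k : ℕ) (l : List ℕ) :
    altWord a b k ++ a :: l = a :: (altWord b a k ++ l) := by
  rw [← List.singleton_append, ← List.append_assoc, altWord_append_singleton, List.cons_append]

theorem altWord_reverse (a b k : ℕ) : (altWord a b k).reverse = altWord b a k := by
  induction k with
  | zero => rfl
  | succ k ih =>
    rw [altWord_succ, List.reverse_cons, List.reverse_cons, ih, altWord_add]
    simp [altWord]

theorem altWord_sum (a b k : ℕ) : (altWord a b k).sum = k * (a + b) := by
  induction k with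
  | zero => simp
  | succ k ih => simp [altWord_succ, ih]; ring

theorem mem_altWord {a b k c : ℕ} (h : c ∈ altWord a b k) : c = a ∨ c = b := by
  simp only [altWord, List.mem_flatten, List.mem_replicate] at h
  obtain ⟨l, ⟨-, rfl⟩, hc⟩ := h
  simpa using hc

/-- The shape of a word whose adjacent entries have sums above `n` and below `2 n`, with ends different
from `n` and with at most one entry strictly between `1` and `n`: it alternates between small
entries and `n`, and all small entries but one are `1`. -/
theorem exists_eq_altWord {n : ℕ} (hn : 2 ≤ n) : ∀ {L : List ℕ}, L ≠ [] →
    (∀ a ∈ L, 1 ≤ a ∧ a ≤ n) → (L.IsChain fun a b => n < a + b) →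
    (L.IsChain fun a b => a + b < 2 * n) →
    (L.Pairwise fun a b => ¬((1 < a ∧ a < n) ∧ 1 < b ∧ b < n)) →
    (∀ a ∈ L.head?, a ≠ n) → (∀ a ∈ L.getLast?, a ≠ n) →
    ∃ s z q, L = altWord 1 n s ++ z :: altWord n 1 q ∧ 1 ≤ z ∧ z < n
  | [], h, _, _, _, _, _, _ => absurd rfl h
  | [y], _, h1, _, _, _, h5, _ => by
    have := h1 y (by simp)
    have := h5 y (by simp)
    exact ⟨0, y, 0, rfl, by omega, by omega⟩
  | [y, b], _, h1, h2, _, h4, h5, h6 => by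
    have := h1 y (by simp)
    have := h1 b (by simp)
    have := h5 y (by simp)
    have := h6 b (by simp)
    simp at h2 h4
    omega
  | y :: b :: c :: L, _, h1, h2, h3, h4, h5, h6 => by
    have hy := h1 y (by simp)
    have hb := h1 b (by simp)
    have hc := h1 c (by simp)
    have hyn := h5 y (by simp)
    rw [List.isChain_cons_cons, List.isChain_cons_cons] at h2 h3
    rw [List.pairwise_cons, List.pairwise_cons] at h4
    have hyb := h4.1 b (by simp)
    obtain rfl : b = n := by omega
    obtain ⟨s, z, q, hL, hz, hz'⟩ := exists_eq_altWord hn (L := c :: L) (by simp)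
      (fun a ha => h1 a (by simp only [List.mem_cons] at ha ⊢; tauto)) h2.2.2 h3.2.2 h4.2.2
      (fun a ha => by simp at ha; omega) (fun a ha => h6 a (by simpa using ha))
    rw [hL]
    by_cases hy1 : y = 1
    · exact ⟨s + 1, z, q, by simp [altWord_succ, hy1], hz, hz'⟩
    · have hyz := h4.1 z (by rw [hL]; simp)
      obtain rfl : z = 1 := by omega
      refine ⟨0, y, s + 1 + q, ?_, hy.1, by omega⟩
      rw [altWord_append_cons, altWord_add, altWord_succ]
      simp

/-- The global shape of some minimal word, with the long run of `n` and the one entry `z` still at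
arbitrary places. -/
theorem exists_isMinWord_altWord {n S : ℕ} (hn : 2 ≤ n) (hS : 2 * n + 2 ≤ S) :
    ∃ p x s z q, 1 ≤ p ∧ 1 ≤ z ∧ z < n ∧
      IsMinWord n S (altWord 1 n p ++ List.replicate x n ++ altWord 1 n s ++ z :: altWord n 1 q) := by
  obtain ⟨w, hw⟩ := exists_isShortMinWord S (show 1 ≤ n by omega)
  have hmem : ∀ a ∈ w, 1 ≤ a ∧ a ≤ n := fun a ha => ⟨hw.1.one_le ha, hw.1.le ha⟩
  have hhead := hw.1.head?_ne hn hS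
  have hlast := hw.1.getLast?_ne hn hS
  by_cases hchain : w.IsChain fun a b => a + b < 2 * n
  · have hne : w ≠ [] := by
      rintro rfl
      have := hw.1.sum_eq
      simp at this
      omega
    obtain ⟨s, z, q, rfl, hz, hz'⟩ :=
      exists_eq_altWord hn hne hmem hw.isChain hchain hw.1.pairwise hhead hlast
    rcases Nat.eq_zero_or_pos s with rfl | hs
    · refine ⟨q, 0, 0, z, 0, ?_, hz, hz', by simpa [altWord_reverse] using hw.1.reverse⟩
      rcases Nat.eq_zero_or_pos q with rfl | hq
      · have := hw.1.sum_eq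
        simp at this
        omega
      · exact hq
    · exact ⟨s, 0, 0, z, q, hs, hz, hz', by simpa using hw.1⟩
  -- Otherwise `w` contains `n, n`, and we extend this to a maximal run.
  obtain ⟨k, P, y, y', Q, rfl, hy, hy'⟩ : ∃ k P y y' Q,
      w = P ++ y :: (List.replicate (k + 2) n ++ y' :: Q) ∧ y ≠ n ∧ y' ≠ n := by
    rw [List.isChain_iff_forall_rel_of_append_cons_cons] at hchain
    push Not at hchain
    obtain ⟨a, b, A, C, rfl, hab⟩ := hchain
    have ha := hmem a (by simp)
    have hb := hmem b (by simp)
    obtain rfl : a = n := by omega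
    obtain rfl : b = a := by omega
    obtain ⟨i, A', rfl, hA'⟩ := List.exists_eq_append_replicate b A
    obtain ⟨j, C', rfl, hC'⟩ := List.exists_eq_replicate_append b C
    rcases List.eq_nil_or_concat A' with rfl | ⟨P, y, rfl⟩
    · refine absurd rfl (hhead b ?_)
      cases i <;> simp [List.replicate_succ]
    rcases C' with _ | ⟨y', Q⟩
    · refine absurd rfl (hlast b ?_)
      rw [List.append_nil, List.getLast?_append, ← List.replicate_succ, ← List.replicate_succ]
      simp [List.getLast?_replicate]
    · refine ⟨i + j, P, y, y', Q, ?_, hA' y (by simp), hC' y' (by simp)⟩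
      rw [show i + j + 2 = i + (j + 2) by omega, List.replicate_add]
      simp [List.replicate_succ]
  have hyn : y < n := lt_of_le_of_ne (hmem y (by simp)).2 hy
  have hyn' : y' < n := lt_of_le_of_ne (hmem y' (by simp)).2 hy'
  have hQ := hw.1.isChain_after_run hyn (R := y' :: Q) (by simpa using hy')
    (fun a ha => hlast a (by simp only [List.getLast?_append, List.getLast?_cons] at ha ⊢; simp_all))
  have hrev : IsMinWord n S (Q.reverse ++ y' :: (List.replicate (k + 2) n ++ (y :: P.reverse))) := by
    simpa using hw.1.reverse
  have hP := hrev.isChain_after_run hyn' (R := y :: P.reverse) (by simpa using hy)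
    (fun a ha => hhead a (by
      rw [← List.getLast?_reverse]
      simp only [List.reverse_append, List.reverse_cons, List.getLast?_append, List.getLast?_cons] at ha ⊢
      simp_all))
  have hchainP := hw.isChain.infix (l₁ := P ++ [y])
    ⟨[], List.replicate (k + 2) n ++ y' :: Q, by simp⟩
  have hchainQ := hw.isChain.infix (l₁ := y' :: Q)
    ⟨P ++ y :: List.replicate (k + 2) n, [], by simp⟩
  have hpair := hw.1.pairwise
  rw [show P ++ y :: (List.replicate (k + 2) n ++ y' :: Q) =
    (P ++ [y]) ++ (List.replicate (k + 2) n ++ y' :: Q) by simp, List.pairwise_append] at hpair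
  have hpair' := (List.pairwise_append.1 hpair.2.1).2.1
  obtain ⟨s, z, q, hL, hz, hz'⟩ := exists_eq_altWord hn (L := P ++ [y]) (by simp)
    (fun a ha => hmem a (by simp at ha ⊢; tauto)) hchainP
    (by
      rw [← List.isChain_reverse]
      simpa [add_comm] using hP)
    hpair.1
    (fun a ha => hhead a (by
      rcases P with _ | ⟨b, P⟩
      · simpa using ha
      · simpa using ha))
    (by simpa using hy)
  obtain ⟨s', u, q', hL', hu, hu'⟩ := exists_eq_altWord hn (L := y' :: Q) (by simp)
    (fun a ha => hmem a (by simp at ha ⊢; tauto)) hchainQ hQ hpair' (by simpa using hy')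
    (fun a ha => hlast a (by simp only [List.getLast?_append, List.getLast?_cons] at ha ⊢; simp_all))
  have hmin : IsMinWord n S ((altWord 1 n s ++ z :: altWord n 1 q) ++
      List.replicate (k + 2) n ++ (altWord 1 n s' ++ u :: altWord n 1 q')) := by
    rw [← hL, ← hL']
    simpa using hw.1
  have hzu := hpair.2.2 z (by rw [hL]; simp) u (by rw [hL']; simp)
  -- A `1` next to the run completes a pair with the first `n` of the run.
  have habsorb : ∀ s q, altWord 1 n s ++ 1 :: altWord n 1 q ++ List.replicate (k + 2) n =
      altWord 1 n (s + q + 1) ++ List.replicate (k + 1) n := by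
    intro s q
    rw [← altWord_append_singleton, List.replicate_succ, add_assoc, altWord_add, altWord_add]
    simp [altWord]
  by_cases hz1 : z = 1
  · subst hz1
    refine ⟨s + q + 1, k + 1, s', u, q', by omega, hu, hu', ?_⟩
    rw [habsorb] at hmin
    simpa using hmin
  · obtain rfl : u = 1 := by omega
    refine ⟨q' + s' + 1, k + 1, q, z, s, by omega, hz, hz', ?_⟩
    have := hmin.reverse
    simp only [List.reverse_append, List.reverse_cons, altWord_reverse, List.reverse_replicate,
      ← List.append_assoc] at this
    rw [← habsorb]
    simpa using this

/-! ### The length of the run of `n` -/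

theorem sandwich_cons_eq_mul {a : ℕ} (l : List ℕ) {α : ℚ} (γ : ℚ) (h : 0 < a + α) :
    sandwich (contMat (a :: l)) α γ = (a + α) * sandwich (contMat l) (a + α)⁻¹ γ := by
  rw [sandwich_cons, sandwich]
  field_simp
  ring

/-- The interval `[0, [0; n, 1, n]]` is mapped into itself by `α ↦ [0; n, 1 + α]`. -/
theorem inv_add_inv_one_add_le {n : ℕ} {α : ℚ} (hn : 1 ≤ n) (h0 : 0 ≤ α)
    (h : α ≤ (n + 1) / (n * (n + 2))) :
    (n + (1 + α)⁻¹)⁻¹ ≤ ((n : ℚ) + 1) / (n * (n + 2)) := by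
  have hn' : (1 : ℚ) ≤ n := by exact_mod_cast hn
  rw [le_div_iff₀ (by positivity)] at h
  have h1 : (n + (1 + α)⁻¹)⁻¹ = (1 + α) / (n * (1 + α) + 1) := by field_simp
  rw [h1, div_le_div_iff₀ (by positivity) (by positivity)]
  have h2 : α * n ≤ 1 := by
    by_contra! h2
    nlinarith
  nlinarith

/-- An upper bound for `1, n, …, 1, n` between bounded ends: the number `(n + 1) / (n (n + 2))`
equals `[0; n, 1, n]`, and the ends obtained by moving past a pair `1, n` stay below it. -/
theorem sandwich_altWord_le {n : ℕ} (hn : 1 ≤ n) (k : ℕ) {α γ : ℚ} (h0 : 0 ≤ α)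
    (h : α ≤ (n + 1) / (n * (n + 2))) (hγ : 0 ≤ γ) :
    sandwich (contMat (altWord 1 n k)) α γ ≤
      (n + 1 + (n + 1) / (n + 2)) ^ k * (1 + (n + 1) / (n * (n + 2)) * γ) := by
  have hn' : (1 : ℚ) ≤ n := by exact_mod_cast hn
  induction k generalizing α with
  | zero =>
    have := mul_le_mul_of_nonneg_right h hγ
    simp [sandwich]
    linarith
  | succ k ih =>
    have hstep := ih (α := (n + (1 + α)⁻¹)⁻¹) (by positivity) (inv_add_inv_one_add_le hn h0 h)
    rw [altWord_succ, sandwich_cons_eq_mul _ _ (by push_cast; positivity),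
      sandwich_cons_eq_mul _ _ (by positivity), ← mul_assoc, pow_succ',
      mul_assoc ((n : ℚ) + 1 + (n + 1) / (n + 2)), Nat.cast_one]
    have hfac : (1 + α) * (n + (1 + α)⁻¹) ≤ n + 1 + (n + 1) / (n + 2) := by
      have h1 : (1 + α) * (n + (1 + α)⁻¹) = n + 1 + n * α := by field_simp; ring
      have h2 : n * α ≤ n * ((n + 1) / (n * (n + 2))) := mul_le_mul_of_nonneg_left h (by positivity)
      have h3 : (n : ℚ) * ((n + 1) / (n * (n + 2))) = (n + 1) / (n + 2) := by field_simp
      linarith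
    exact (mul_le_mul_of_nonneg_left hstep (by positivity)).trans
      (mul_le_mul_of_nonneg_right hfac (by positivity))

/-- A lower bound for a run of `n`: each copy contributes a factor of at least `n + 1 / (n + 1)`. -/
theorem le_sandwich_replicate {n : ℕ} (hn : 1 ≤ n) (k : ℕ) {α γ : ℚ}
    (h : 1 / ((n : ℚ) + 1) ≤ α) (h1 : α ≤ 1) (hγ : 0 ≤ γ) :
    (n + 1 / ((n : ℚ) + 1)) ^ k * (n + 1 / (n + 1) + γ) ≤
      sandwich (contMat (List.replicate (k + 1) n)) α γ := by
  have hn' : (1 : ℚ) ≤ n := by exact_mod_cast hn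
  have h0 : 0 ≤ α := le_trans (by positivity) h
  induction k generalizing α with
  | zero =>
    rw [zero_add, List.replicate_one, sandwich_singleton]
    linarith
  | succ k ih =>
    have hinv : 1 / ((n : ℚ) + 1) ≤ (n + α)⁻¹ := by
      rw [one_div]
      exact inv_anti₀ (by positivity) (by linarith)
    have hstep := ih hinv (inv_le_one_of_one_le₀ (by linarith)) (by positivity)
    rw [List.replicate_succ, sandwich_cons_eq_mul _ _ (by positivity), pow_succ', mul_assoc]
    refine mul_le_mul (by linarith) hstep (by positivity) (by positivity)

theorem pow_lt_pow_of_three_le {n : ℕ} (hn : 3 ≤ n) :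
    ((n : ℚ) + 1 + (n + 1) / (n + 2)) ^ n < (n + 1 / ((n : ℚ) + 1)) ^ (n + 1) := by
  rcases Nat.lt_or_ge n 8 with h8 | h8
  · interval_cases n <;> norm_num
  -- For `n ≥ 8`, use `(n + 2) ^ n ≤ e ^ 2 * n ^ n < 8 * n ^ n`.
  have hn0 : (0 : ℝ) < n := by positivity
  have hexp : ((n : ℝ) + 2) ^ n < 8 * n ^ n := by
    have h1 : (n : ℝ) + 2 ≤ n * Real.exp (2 / n) := by
      have := mul_le_mul_of_nonneg_left (Real.add_one_le_exp (2 / (n : ℝ))) hn0.le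
      rwa [mul_add, mul_div_cancel₀ _ hn0.ne', mul_one, add_comm] at this
    have h2 : Real.exp (2 / n) ^ n = Real.exp 1 ^ 2 := by
      rw [← Real.exp_nat_mul, ← Real.exp_nat_mul]
      congr 1
      field_simp
      norm_num
    have h3 : Real.exp 1 ^ 2 < 8 := by
      have := Real.exp_one_lt_d9
      have := Real.exp_pos 1
      nlinarith
    calc ((n : ℝ) + 2) ^ n ≤ (n * Real.exp (2 / n)) ^ n := by gcongr
      _ = Real.exp 1 ^ 2 * n ^ n := by rw [mul_pow, h2, mul_comm]
      _ < 8 * n ^ n := by gcongr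
  have hexp' : ((n : ℚ) + 2) ^ n < 8 * n ^ n := by exact_mod_cast hexp
  have hq : (8 : ℚ) ≤ n := by exact_mod_cast h8
  have hle : ((n : ℚ) + 1) / (n + 2) ≤ 1 := div_le_one_of_le₀ (by linarith) (by positivity)
  have hpos : (0 : ℚ) ≤ 1 / (n + 1) := by positivity
  calc ((n : ℚ) + 1 + (n + 1) / (n + 2)) ^ n ≤ (n + 2) ^ n :=
        pow_le_pow_left₀ (by positivity) (by linarith) n
    _ < 8 * n ^ n := hexp'
    _ ≤ n * n ^ n := by gcongr
    _ = n ^ (n + 1) := (pow_succ' _ _).symm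
    _ ≤ (n + 1 / ((n : ℚ) + 1)) ^ (n + 1) := pow_le_pow_left₀ (by positivity) (by linarith) _

/-- Replacing `n + 1` copies of `n` by `n` pairs `1, n` lowers the continuant. -/
theorem sandwich_altWord_lt_replicate {n : ℕ} (hn : 2 ≤ n) {α γ : ℚ}
    (h : 1 / ((n : ℚ) + 1) ≤ α) (h1 : α ≤ (n + 1) / (n * (n + 2)))
    (hγ : 1 / ((n : ℚ) + 1) ≤ γ) :
    sandwich (contMat (altWord 1 n n)) α γ < sandwich (contMat (List.replicate (n + 1) n)) α γ := by
  have h0 : 0 ≤ α := le_trans (by positivity) h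
  have hγ0 : 0 ≤ γ := le_trans (by positivity) hγ
  rcases hn.eq_or_lt with rfl | hn
  · -- For `n = 2` the bounds above are too weak.
    norm_num [sandwich, altWord, contMat, List.replicate_succ, Matrix.mul_apply] at *
    nlinarith [mul_nonneg (sub_nonneg.2 h1) (sub_nonneg.2 hγ)]
  have hn' : (3 : ℚ) ≤ n := by exact_mod_cast hn
  have hα1 : α ≤ 1 := by
    refine h1.trans (div_le_one_of_le₀ ?_ (by positivity))
    nlinarith
  refine (sandwich_altWord_le (by omega) n h0 h1 hγ0).trans_lt
    (lt_of_lt_of_le ?_ (le_sandwich_replicate (by omega) n h hα1 hγ0))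
  have hc : (n : ℚ) + 1 / (n + 1) + γ =
      (n + 1 / (n + 1)) * (1 + (n + 1) / (n ^ 2 + n + 1) * γ) := by
    have : (n : ℚ) + 1 / (n + 1) = (n ^ 2 + n + 1) / (n + 1) := by field_simp
    rw [this]
    field_simp
  rw [hc, ← mul_assoc, ← pow_succ]
  refine mul_lt_mul (pow_lt_pow_of_three_le hn) ?_ (by positivity) (by positivity)
  gcongr
  nlinarith

theorem contFrac_altWord_succ (n k : ℕ) :
    contFrac (altWord n 1 (k + 1)) = (n + (1 + contFrac (altWord n 1 k))⁻¹)⁻¹ := by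
  rw [altWord_succ, contFrac_cons, contFrac_cons, Nat.cast_one]

theorem contFrac_altWord_strictMono {n : ℕ} (hn : 1 ≤ n) :
    StrictMono fun k => contFrac (altWord n 1 k) := by
  have hn' : (1 : ℚ) ≤ n := by exact_mod_cast hn
  refine strictMono_nat_of_lt_succ fun k => ?_
  induction k with
  | zero =>
    simp only [altWord_zero, contFrac_altWord_succ, contFrac_nil]
    positivity
  | succ k ih =>
    have h0 := contFrac_nonneg (altWord n 1 k)
    have h1 := contFrac_nonneg (altWord n 1 (k + 1))
    rw [contFrac_altWord_succ n k, contFrac_altWord_succ n (k + 1)]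
    have h2 : (1 + contFrac (altWord n 1 (k + 1)))⁻¹ < (1 + contFrac (altWord n 1 k))⁻¹ :=
      inv_strictAnti₀ (by linarith) (by linarith)
    exact inv_strictAnti₀ (by positivity) (by linarith)

theorem contFrac_altWord_le {n : ℕ} (hn : 1 ≤ n) (k : ℕ) :
    contFrac (altWord n 1 k) ≤ (n + 1) / (n * (n + 2)) := by
  induction k with
  | zero => simp; positivity
  | succ k ih =>
    rw [contFrac_altWord_succ]
    exact inv_add_inv_one_add_le hn (contFrac_nonneg _) ih

theorem le_contFrac {n : ℕ} {l : List ℕ} (hl : ∀ a ∈ l, 1 ≤ a ∧ a ≤ n) (hne : l ≠ []) :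
    1 / ((n : ℚ) + 1) ≤ contFrac l := by
  cases l with
  | nil => exact absurd rfl hne
  | cons a l =>
    have h0 := contFrac_nonneg l
    have h1 := contFrac_le_one fun b hb => (hl b (List.mem_cons_of_mem _ hb)).1
    have ha : (1 : ℚ) ≤ a := by exact_mod_cast (hl a List.mem_cons_self).1
    have ha' : (a : ℚ) ≤ n := by exact_mod_cast (hl a List.mem_cons_self).2
    rw [contFrac_cons, one_div]
    exact inv_anti₀ (by linarith) (by linarith)

namespace IsMinWord

variable {n S p x s z q : ℕ} {C : List ℕ}

theorem run_le (hn : 2 ≤ n) (hp : 1 ≤ p) (hC : C ≠ [])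
    (h : IsMinWord n S (altWord 1 n p ++ List.replicate x n ++ C)) : x ≤ n := by
  by_contra! hx
  obtain ⟨y, rfl⟩ := Nat.exists_eq_add_of_le (Nat.succ_le_of_lt hx)
  have h' : IsMinWord n S (altWord 1 n p ++ List.replicate (n + 1) n ++ (List.replicate y n ++ C)) := by
    rw [Nat.succ_eq_add_one, List.replicate_add] at h
    simpa only [List.append_assoc] using h
  have hle := h'.sandwich_le (B' := altWord 1 n n)
    (fun a ha => by rcases mem_altWord ha with rfl | rfl <;> omega)
    (by rw [altWord_sum]; simp; ring)
  refine absurd hle (not_le.2 ?_)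
  rw [altWord_reverse]
  refine sandwich_altWord_lt_replicate hn (le_contFrac (fun a ha => ?_) ?_)
    (contFrac_altWord_le (by omega) p) (le_contFrac (fun a ha => ⟨h'.one_le ?_, h'.le ?_⟩) (by simp [hC]))
  · rcases mem_altWord ha with rfl | rfl <;> omega
  · obtain ⟨p, rfl⟩ := Nat.exists_eq_add_of_le' hp
    simp [altWord_succ]
  · exact List.mem_append_right _ ha
  · exact List.mem_append_right _ ha

/-! ### Balancing the two alternating parts -/

/-- No pairs separate the long run from an entry `z > 1`: they would be reversed together with `z`. -/
theorem eq_zero_of_between (hn : 2 ≤ n) (hp : 1 ≤ p) (hx : 1 ≤ x) (hz : 1 < z)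
    (h : IsMinWord n S
      (altWord 1 n p ++ List.replicate x n ++ altWord 1 n s ++ z :: altWord n 1 q)) : s = 0 := by
  by_contra hs
  obtain ⟨s, rfl⟩ := Nat.exists_eq_succ_of_ne_zero hs
  have h' : IsMinWord n S ((altWord 1 n p ++ List.replicate x n) ++ (altWord 1 n (s + 1) ++ [z])
      ++ altWord n 1 q) := by simpa using h
  have hA : contFrac (altWord n 1 q) < contFrac (altWord 1 n p ++ List.replicate x n).reverse := by
    obtain ⟨l, hl⟩ : ∃ l, (altWord 1 n p ++ List.replicate x n).reverse = n :: n :: l := by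
      obtain ⟨p, rfl⟩ := Nat.exists_eq_add_of_le' hp
      obtain ⟨x, rfl⟩ := Nat.exists_eq_add_of_le' hx
      rw [List.reverse_append, List.reverse_replicate, altWord_reverse, altWord_succ]
      cases x <;> simp [List.replicate_succ]
    have hl1 : ∀ a ∈ n :: n :: l, 1 ≤ a := by
      rw [← hl]
      intro a ha
      exact h'.one_le (List.mem_append_left _ (List.mem_append_left _ (List.mem_reverse.1 ha)))
    rw [hl]
    cases q with
    | zero => exact contFrac_pos hl1 (by simp)
    | succ q =>
      rw [altWord_succ, contFrac_cons_lt_iff (by omega) (by omega), add_lt_add_iff_left]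
      refine contFrac_cons_lt ?_ ?_ le_rfl (by omega) (Or.inl ?_)
      · intro a ha
        rcases mem_altWord ha with rfl | rfl <;> omega
      · intro a ha
        exact hl1 a (by simp [ha])
      · cases q <;> simp [altWord_succ]
  refine absurd (h'.not_reverse_gt hA) (not_le.2 ?_)
  rw [List.reverse_append, altWord_reverse, List.reverse_singleton, List.singleton_append]
  conv_rhs => rw [altWord_succ, List.cons_append]
  refine contFrac_cons_lt ?_ ?_ le_rfl hz (Or.inr (by simp [altWord_succ]))
  · intro a ha
    exact h'.one_le (by simp [altWord_succ] at ha ⊢; tauto)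
  · intro a ha
    rcases mem_altWord ha with rfl | rfl <;> omega

/-- If there are more pairs behind than in front, the block `n, …, n, z` would be reversed. -/
theorem le_of_run (hn : 2 ≤ n) (hx : 1 ≤ x) (hz : z < n)
    (h : IsMinWord n S (altWord 1 n p ++ List.replicate x n ++ z :: altWord n 1 q)) : q ≤ p := by
  by_contra! hpq
  have h' : IsMinWord n S (altWord 1 n p ++ (List.replicate x n ++ [z]) ++ altWord n 1 q) := by
    simpa using h
  have hz1 : 1 ≤ z := h.one_le (by simp)
  refine absurd (h'.not_reverse_lt ?_) (not_le.2 ?_)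
  · rw [altWord_reverse]
    exact contFrac_altWord_strictMono (by omega) hpq
  · obtain ⟨x, rfl⟩ := Nat.exists_eq_add_of_le' hx
    rw [List.reverse_append, List.reverse_replicate, List.reverse_singleton,
      List.singleton_append]
    conv_lhs => rw [List.replicate_succ, List.cons_append]
    refine contFrac_cons_lt ?_ ?_ hz1 hz (Or.inr (by simp))
    · intro a ha
      rw [List.eq_of_mem_replicate ha]
      omega
    · intro a ha
      simp at ha
      omega

/-- If there are too many pairs in front, everything from the pair number `q + 2` up to `z` would be
reversed. -/
theorem le_succ_of_one_lt (hn : 2 ≤ n) (hz : 1 < z)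
    (h : IsMinWord n S (altWord 1 n p ++ List.replicate x n ++ z :: altWord n 1 q)) :
    p ≤ q + 1 := by
  by_contra! hpq
  obtain ⟨d, rfl⟩ := Nat.exists_eq_add_of_le (Nat.succ_le_of_lt hpq)
  have h' : IsMinWord n S (altWord 1 n (q + 1) ++ (altWord 1 n (d + 1) ++ List.replicate x n ++ [z])
      ++ altWord n 1 q) := by
    rw [show (q + 1).succ + d = (q + 1) + (d + 1) by omega, altWord_add] at h
    simpa using h
  refine absurd (h'.not_reverse_gt ?_) (not_le.2 ?_)
  · rw [altWord_reverse]
    exact contFrac_altWord_strictMono (by omega) (Nat.lt_succ_self q)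
  · have hB : ∀ a ∈ altWord 1 n (d + 1) ++ List.replicate x n ++ [z], 1 ≤ a := fun a ha =>
      h'.one_le (List.mem_append_left _ (List.mem_append_right _ ha))
    simp only [List.reverse_append, List.reverse_replicate, List.reverse_singleton,
      List.singleton_append, altWord_reverse]
    conv_rhs => rw [altWord_succ, List.cons_append, List.cons_append]
    refine contFrac_cons_lt ?_ ?_ le_rfl hz (Or.inr (by simp [altWord_succ]))
    · intro a ha
      exact hB a (by simp [altWord_succ] at ha ⊢; tauto)
    · intro a ha
      refine hB a ?_
      simp only [List.mem_append, ← altWord_reverse n 1, List.mem_reverse] at ha ⊢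
      tauto

/-- The analogue of `le_succ_of_one_lt` for `z = 1`. The block has to start one pair earlier, as
`1, n, n, …, n, 1` is a palindrome. -/
theorem le_succ_succ_of_one (hn : 2 ≤ n) (hx : 1 ≤ x)
    (h : IsMinWord n S (altWord 1 n p ++ List.replicate x n ++ 1 :: altWord n 1 q)) :
    p ≤ q + 2 := by
  by_contra! hpq
  obtain ⟨d, rfl⟩ := Nat.exists_eq_add_of_le (Nat.succ_le_of_lt hpq)
  obtain ⟨x, rfl⟩ := Nat.exists_eq_add_of_le' hx
  have h' : IsMinWord n S (altWord 1 n (q + 1) ++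
      (altWord 1 n (d + 2) ++ List.replicate (x + 1) n ++ [1]) ++ altWord n 1 q) := by
    rw [show (q + 2).succ + d = (q + 1) + (d + 2) by omega, altWord_add] at h
    simpa using h
  refine absurd (h'.not_reverse_gt ?_) (not_le.2 ?_)
  · rw [altWord_reverse]
    exact contFrac_altWord_strictMono (by omega) (Nat.lt_succ_self q)
  · have hB : ∀ a ∈ altWord 1 n (d + 2) ++ List.replicate (x + 1) n ++ [1], 1 ≤ a := fun a ha =>
      h'.one_le (List.mem_append_left _ (List.mem_append_right _ ha))
    obtain ⟨l, hl⟩ : ∃ l, (altWord 1 n (d + 2) ++ List.replicate (x + 1) n ++ [1]).reverse =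
        1 :: n :: n :: l := by
      simp only [List.reverse_append, List.reverse_replicate, altWord_reverse]
      simp only [altWord_succ]
      cases x <;> simp [List.replicate_succ]
    have hl1 : ∀ a ∈ 1 :: n :: n :: l, 1 ≤ a := by
      rw [← hl]
      exact fun a ha => hB a (List.mem_reverse.1 ha)
    rw [hl]
    simp only [altWord_succ, List.cons_append] at hB ⊢
    rw [contFrac_cons_lt_iff le_rfl le_rfl, add_lt_add_iff_left,
      contFrac_cons_lt_iff (by omega) (by omega), add_lt_add_iff_left]
    refine contFrac_cons_lt ?_ ?_ le_rfl (by omega) (Or.inl ?_)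
    · intro a ha
      exact hB a (by simp only [List.mem_cons] at ha ⊢; tauto)
    · intro a ha
      exact hl1 a (by simp [ha])
    · simp

/-- Some minimal word has its long run of `n` and its entry `z` side by side in the middle, where
`m` counts the pairs of `1` and `n` on both sides. -/
theorem exists_balanced (hn : 2 ≤ n) (hS : 2 * n + 2 ≤ S) :
    ∃ m x z, 1 ≤ m ∧ x ≤ n ∧ 1 ≤ z ∧ z < n ∧ IsMinWord n S
      (altWord 1 n (m - m / 2) ++ List.replicate x n ++ z :: altWord n 1 (m / 2)) := by
  obtain ⟨p, x, s, z, q, hp, hz, hz', h⟩ := exists_isMinWord_altWord hn hS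
  have hx : x ≤ n := run_le hn hp (C := altWord 1 n s ++ z :: altWord n 1 q) (by simp)
    (by simpa using h)
  obtain ⟨p, q, hp, h⟩ : ∃ p q, 1 ≤ p ∧
      IsMinWord n S (altWord 1 n p ++ List.replicate x n ++ z :: altWord n 1 q) := by
    rcases Nat.eq_zero_or_pos x with rfl | hx0
    · exact ⟨p + s, q, by omega, by simpa [altWord_add] using h⟩
    rcases hz.eq_or_lt with rfl | hz1
    · refine ⟨p, s + q, hp, ?_⟩
      rw [List.append_assoc, altWord_append_cons, ← altWord_add] at h
      exact h
    · obtain rfl := h.eq_zero_of_between hn hp hx0 hz1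
      exact ⟨p, q, hp, by simpa using h⟩
  have hfin : ∀ {p q : ℕ}, 1 ≤ p → q ≤ p → p ≤ q + 1 →
      IsMinWord n S (altWord 1 n p ++ List.replicate x n ++ z :: altWord n 1 q) →
      ∃ m x z, 1 ≤ m ∧ x ≤ n ∧ 1 ≤ z ∧ z < n ∧ IsMinWord n S
        (altWord 1 n (m - m / 2) ++ List.replicate x n ++ z :: altWord n 1 (m / 2)) := by
    intro p q hp hqp hpq h
    refine ⟨p + q, x, z, by omega, hx, hz, hz', ?_⟩
    rwa [show (p + q) / 2 = q by omega, show p + q - q = p by omega]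
  rcases hz.eq_or_lt with rfl | hz1 <;> rcases Nat.eq_zero_or_pos x with rfl | hx0
  · -- Here the word is a palindrome `1, n, 1, …, n, 1`, and may be cut at any `1`.
    rw [List.replicate_zero, List.append_nil, altWord_append_cons, ← altWord_add] at h
    refine ⟨p + q, 0, 1, by omega, by omega, le_rfl, hz', ?_⟩
    rw [List.replicate_zero, List.append_nil, altWord_append_cons, ← altWord_add]
    rwa [show p + q - (p + q) / 2 + (p + q) / 2 = p + q by omega]
  · have h1 := h.le_of_run hn hx0 hz'
    have h2 := h.le_succ_succ_of_one hn hx0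
    by_cases hpq : p ≤ q + 1
    · exact hfin hp h1 hpq h
    · obtain rfl : p = q + 2 := by omega
      -- Reversal moves a pair from the front to the back, since `z = 1` completes a pair.
      refine hfin (p := q + 1) (q := q + 1) (by omega) le_rfl (by omega) ?_
      have hrev := h.reverse
      obtain ⟨x, rfl⟩ := Nat.exists_eq_add_of_le' hx0
      have e : (altWord 1 n (q + 2) ++ List.replicate (x + 1) n ++ 1 :: altWord n 1 q).reverse =
          altWord 1 n (q + 1) ++ List.replicate (x + 1) n ++ 1 :: altWord n 1 (q + 1) := by
        simp only [List.reverse_append, List.reverse_cons, altWord_reverse, List.reverse_replicate]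
        rw [show q + 2 = 1 + (q + 1) by omega, altWord_add n 1 1, altWord_add 1 n q 1]
        conv_lhs => rw [List.replicate_succ]
        conv_rhs => rw [List.replicate_succ']
        simp [altWord]
      rwa [e] at hrev
  · rcases Nat.lt_or_ge p q with hpq | hpq
    · have hrev : IsMinWord n S (altWord 1 n q ++ List.replicate 0 n ++ z :: altWord n 1 p) := by
        simpa [altWord_reverse] using h.reverse
      exact hfin (by omega) hpq.le (hrev.le_succ_of_one_lt hn hz1) hrev
    · exact hfin hp hpq (h.le_succ_of_one_lt hn hz1) h
  · exact hfin hp (h.le_of_run hn hx0 hz') (h.le_succ_of_one_lt hn hz1) h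

end IsMinWord

/-! ### The parameters `z`, `x`, `m` -/

/-- A decomposition `S = m (n + 1) + n x + z` in the given ranges is the one of the theorem, and its
`z` automatically lies in `P*(S)`. -/
theorem mem_PStar_of_eq {n S m x z : ℕ} (hm : 1 ≤ m) (hx : x ≤ n) (hz : 1 ≤ z)
    (hzn : z < n) (hS : S = m * (n + 1) + n * x + z) :
    z ∈ PStar n S ∧ xOf n S z = x ∧ mOf n S z = m := by
  have hxOf : (x : ℤ) = xOf n S z := by
    refine (eq_xOf_iff n S z x).2 ⟨by positivity, by exact_mod_cast hx, ?_⟩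
    refine Int.modEq_iff_dvd.2 ⟨-(m + x), ?_⟩
    rw [hS]
    push_cast
    ring
  have hmOf : mOf n S z = m := by
    have h := mOf_mul n S z
    rw [← hxOf] at h
    have h2 : ((n : ℤ) + 1) * mOf n S z = (n + 1) * m := by
      rw [h, hS]
      push_cast
      ring
    exact mul_left_cancel₀ (by positivity) h2
  refine ⟨Finset.mem_filter.2 ⟨?_, by rw [hmOf]; exact_mod_cast hm⟩, hxOf.symm, hmOf⟩
  rw [P]
  split_ifs with h1 h2
  all_goals simp only [Finset.mem_union, Finset.mem_Icc]
  · omega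
  all_goals
    -- With `S = a n + b`, comparing the two representations gives
    -- `e n = m + z - b` with `e = a - m - x`, which forces `e = 0` or `e = 1`.
    obtain ⟨a, b, ha, hb, hbn, han⟩ : ∃ a b, S = n * a + b ∧ S % n = b ∧ b < n ∧ a + 1 ≤ n := by
      refine ⟨S / n, S % n, (Nat.div_add_mod S n).symm, rfl, Nat.mod_lt _ (by omega), ?_⟩
      rw [Nat.succ_le_iff, Nat.div_lt_iff_lt_mul (by omega)]
      have : n * n = n ^ 2 := by ring
      omega
    have hmx : m + x ≤ a := by
      by_contra! hlt
      have := Nat.mul_le_mul_left n (Nat.succ_le_of_lt hlt)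
      rw [Nat.mul_succ] at this
      linarith
    obtain ⟨e, rfl⟩ := Nat.exists_eq_add_of_le hmx
    have he : n * e + b = m + z := by linarith
    have hS₁ : S₁ n S = b := hb
    have hS₀ : S₀ n S = if m + x + e < b then b - (m + x + e) else n + 1 + b - (m + x + e) := by
      rw [S₀]
      split_ifs with hab
      · obtain ⟨c, hc⟩ := Nat.exists_eq_add_of_lt hab
        rw [show S - 1 = c + (n + 1) * (m + x + e) by rw [ha, hc]; ring_nf; omega,
          Nat.add_mul_mod_self_left, Nat.mod_eq_of_lt (by omega)]
        omega
      · obtain ⟨c, hc⟩ := Nat.exists_eq_add_of_le' (show 1 ≤ m + x + e by omega)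
        rw [show S - 1 = (n + b - (m + x + e)) + (n + 1) * c by
            have h3 : (n + 1) * c + (n + 1) = n * (m + x + e) + (m + x + e) := by rw [hc]; ring
            omega,
          Nat.add_mul_mod_self_left, Nat.mod_eq_of_lt (by omega)]
        omega
    have he2 : e < 2 := by
      by_contra! h2e
      have := Nat.mul_le_mul_left n h2e
      omega
    interval_cases e <;> split_ifs at hS₀ <;> omega

theorem one_le_and_lt_of_mem_P {n S z : ℕ} (hn : 2 ≤ n) (h : z ∈ P n S) : 1 ≤ z ∧ z < n := by
  have h0 : 1 ≤ S₀ n S := Nat.succ_pos _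
  have h1 : S₁ n S < n := Nat.mod_lt _ (by omega)
  rw [P] at h
  split_ifs at h <;> simp only [Finset.mem_union, Finset.mem_Icc] at h <;> omega

theorem T_eq_continuant (n z m x : ℕ) :
    T n z m x =
      continuant (altWord 1 n (m - m / 2) ++ List.replicate x n ++ z :: altWord n 1 (m / 2)) := by
  simp [T, middleBlock, altWord]

theorem theorem7 (n S : ℕ) (hn : 2 ≤ n) (hS : 2 * n + 2 ≤ S) :
    ∃ M : ℕ, IsLeast (continuant '' allBoundedSeqs n S) M ∧
      IsLeast ((fun z : ℕ => T n z (mOf n S z).toNat (xOf n S z)) '' (PStar n S : Set ℕ)) M := by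
  obtain ⟨m, x, z, hm, hx, hz, hz', h⟩ := IsMinWord.exists_balanced hn hS
  have hsum : ∀ m x z : ℕ,
      (altWord 1 n (m - m / 2) ++ List.replicate x n ++ z :: altWord n 1 (m / 2)).sum =
        m * (n + 1) + n * x + z := by
    intro m x z
    obtain ⟨d, hd⟩ := Nat.exists_eq_add_of_le (Nat.div_le_self m 2)
    simp only [List.sum_append, List.sum_cons, altWord_sum, List.sum_replicate, smul_eq_mul]
    rw [show m - m / 2 = d by omega]
    conv_rhs => rw [hd]
    ring
  obtain ⟨hmem, hx', hm'⟩ := mem_PStar_of_eq hm hx hz hz' (h.sum_eq.symm.trans (hsum m x z))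
  refine ⟨_, ⟨⟨_, h.1, rfl⟩, ?_⟩, ⟨⟨z, hmem, ?_⟩, ?_⟩⟩
  · rintro _ ⟨v, hv, rfl⟩
    exact h.2 v hv
  · simp only [hx', hm', Int.toNat_natCast, T_eq_continuant]
  · rintro _ ⟨u, hu, rfl⟩
    obtain ⟨huP, hu1⟩ := Finset.mem_filter.1 (Finset.mem_coe.1 hu)
    have hun := one_le_and_lt_of_mem_P hn huP
    have hx0 := ((eq_xOf_iff n S u _).1 rfl).1
    have hmul := mOf_mul n S u
    obtain ⟨y, hy⟩ := Int.eq_ofNat_of_zero_le hx0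
    obtain ⟨k, hk⟩ := Int.eq_ofNat_of_zero_le (show 0 ≤ mOf n S u by omega)
    simp only [hy, hk, Int.toNat_natCast, T_eq_continuant]
    refine h.2 _ (mem_allBoundedSeqs.2 ⟨fun a ha => ?_, ?_⟩)
    · simp only [List.mem_append, List.mem_cons] at ha
      rcases ha with (ha | ha) | rfl | ha
      · rcases mem_altWord ha with rfl | rfl <;> omega
      · rw [List.eq_of_mem_replicate ha]
        omega
      · omega
      · rcases mem_altWord ha with rfl | rfl <;> omega
    · rw [hsum]
      rw [hy, hk] at hmul
      zify
      linarith
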